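/- Let $\Omega$ be a state space with two elements, $\Delta(\Omega)$ the set of beliefs on $\Omega$, and $p\in\Delta(\Omega)$ a prior with full support. Let $A$ be a non-empty compact metric space of actions, $u_S:A\to\mathbb{R}$ the (state-independent) utility of the sender and $u_R:\Omega\times A\to\mathbb{R}$ the utility of the receiver, both continuous. For $\mu\in\Delta(\Omega)$ put $\mathbf{V}(\mu)=\mathrm{co}\big(u_S(\arg\max_{a\in A}\mathbb{E}_\mu[u_R(\omega,a)])\big)$ and $\overline V(\mu)=\max\mathbf{V}(\mu)$. A measurable selection $V\in\mathbf{V}$ is a measurable $V:\Delta(\Omega)\to\mathbb{R}$ with $V(\mu)\in\mathbf{V}(\mu)$ for all $\mu$. The value of mediation $\mathcal{V}_{MD}(p)$ is the supremum of $\int V\,d\tau$ over all Borel probability measures $\tau$ on $\Delta(\Omega)$ and all measurable selections $V\in\mathbf{V}$ with $\int\mu\,d\tau(\mu)=p$ and $\mathrm{Cov}_\tau[V(\mu),\mu]=0$. The value of cheap talk $\mathcal{V}_{CT}(p)$ is the supremum of $\int V\,d\tau$ over all such $\tau$ and $V$ with $\int\mu\,d\tau(\mu)=p$ and $V$ constant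 on $\mathrm{supp}(\tau)$. Let $\overline V_{CT}(p)$ be the value at $p$ of the quasiconcave envelope of $\overline V$, that is, of the pointwise infimum of all quasiconcave functions on $\Delta(\Omega)$ that majorize $\overline V$. Identify a belief $\mu$ with the probability in $[0,1]$ that it gives to a fixed one of the two states. A correspondence $\mathbf{U}:[0,1]\rightrightarrows\mathbb{R}$ with non-empty compact values is mono-crossing if either (from below) for all $x<x'$, $\max\mathbf{U}(x)>0$ implies $\min\mathbf{U}(x')\ge 0$, or (from above) for all $x<x'$, $\min\mathbf{U}(x)<0$ implies $\max\mathbf{U}(x')\le 0$. Suppose that no disclosure is suboptimal under cheap talk, i.e. $\overline V(p)<\mathcal{V}_{CT}(p)$. Then $\mathcal{V}_{MD}(p)=\mathcal{V}_{CT}(p)$ if and only if the correspondence $\mu\mapsto\mathbf{V}(\mu)-\overline V_{CT}(p)$ is mono-crossing. -/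

import Mathlib

open MeasureTheory

noncomputable section

namespace MediatedCommunication

/-- Beliefs over a finite state space: the standard simplex `Δ(Ω)`, with the topology and
the Borel σ-algebra inherited from `ℝ^Ω`. -/
abbrev Belief (Ω : Type*) [Fintype Ω] : Type _ := ↥(stdSimplex ℝ Ω)

section Model

variable {Ω A : Type*} [Fintype Ω]

/-- The receiver's expected utility `E_μ[u_R(ω, a)]`. -/
def receiverPayoff (uR : Ω → A → ℝ) (μ : Belief Ω) (a : A) : ℝ :=
  ∑ ω, (μ : Ω → ℝ) ω * uR ω a

/-- The receiver's best responses `argmax_{a ∈ A} E_μ[u_R(ω, a)]`. -/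
def bestResponses (uR : Ω → A → ℝ) (μ : Belief Ω) : Set A :=
  {a | ∀ a', receiverPayoff uR μ a' ≤ receiverPayoff uR μ a}

/-- The indirect value correspondence `𝐕(μ) = co (u_S (argmax_a E_μ[u_R(ω, a)]))`. -/
def valueCorrespondence (uS : A → ℝ) (uR : Ω → A → ℝ) (μ : Belief Ω) : Set ℝ :=
  convexHull ℝ (uS '' bestResponses uR μ)

end Model

/-- Upper envelope `x ↦ max 𝐔(x)` of a correspondence (with non-empty compact values). -/
def upperEnvelope {X : Type*} (U : X → Set ℝ) (x : X) : ℝ := sSup (U x)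

/-- Lower envelope `x ↦ min 𝐔(x)` of a correspondence (with non-empty compact values). -/
def lowerEnvelope {X : Type*} (U : X → Set ℝ) (x : X) : ℝ := sInf (U x)

/-- Mono-crossing from below: for `x < x'`, `max 𝐔(x) > 0` implies `min 𝐔(x') ≥ 0`. -/
def MonoCrossingFromBelow {X : Type*} [Preorder X] (U : X → Set ℝ) : Prop :=
  ∀ x x' : X, x < x' → 0 < upperEnvelope U x → 0 ≤ lowerEnvelope U x'

/-- Mono-crossing from above: for `x < x'`, `min 𝐔(x) < 0` implies `max 𝐔(x') ≤ 0`. -/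
def MonoCrossingFromAbove {X : Type*} [Preorder X] (U : X → Set ℝ) : Prop :=
  ∀ x x' : X, x < x' → lowerEnvelope U x < 0 → upperEnvelope U x' ≤ 0

/-- Mono-crossing (weak single-crossing). -/
def MonoCrossing {X : Type*} [Preorder X] (U : X → Set ℝ) : Prop :=
  MonoCrossingFromBelow U ∨ MonoCrossingFromAbove U

section Communication

variable {Ω : Type*} [Fintype Ω]

/-- `V ∈ 𝐕`: `V` is a measurable selection of the correspondence `𝐕`. -/
def IsMeasurableSelection (VV : Belief Ω → Set ℝ) (V : Belief Ω → ℝ) : Prop :=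
  Measurable V ∧ ∀ μ, V μ ∈ VV μ

/-- Bayes plausibility `∫ μ dτ(μ) = p`, coordinate by coordinate. -/
def BayesPlausible (p : Belief Ω) (τ : ProbabilityMeasure (Belief Ω)) : Prop :=
  ∀ ω, ∫ μ, (μ : Ω → ℝ) ω ∂(τ : Measure (Belief Ω)) = (p : Ω → ℝ) ω

/-- Honesty under mediation: `Cov_τ[V(μ), μ] = 0`, coordinate by coordinate. -/
def ZeroCov (τ : ProbabilityMeasure (Belief Ω)) (V : Belief Ω → ℝ) : Prop :=
  ∀ ω, ProbabilityTheory.covariance V (fun μ => (μ : Ω → ℝ) ω)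
    (τ : Measure (Belief Ω)) = 0

/-- `(τ, V)` is feasible in the mediation problem at the prior `p`. -/
def MediationFeasible (VV : Belief Ω → Set ℝ) (p : Belief Ω)
    (τ : ProbabilityMeasure (Belief Ω)) (V : Belief Ω → ℝ) : Prop :=
  IsMeasurableSelection VV V ∧ BayesPlausible p τ ∧ ZeroCov τ V

/-- `(τ, V)` is feasible in the cheap talk problem at the prior `p`: instead of being merely
uncorrelated with the belief, `V` is constant on the support of `τ`. -/
def CheapTalkFeasible (VV : Belief Ω → Set ℝ) (p : Belief Ω)
    (τ : ProbabilityMeasure (Belief Ω)) (V : Belief Ω → ℝ) : Prop :=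
  IsMeasurableSelection VV V ∧ BayesPlausible p τ ∧
    ∃ c : ℝ, ∀ μ ∈ (τ : Measure (Belief Ω)).support, V μ = c

/-- The sender's optimal value under mediation, `𝒱_MD(p)`. -/
def mediationValue (VV : Belief Ω → Set ℝ) (p : Belief Ω) : ℝ :=
  sSup {s | ∃ τ V, MediationFeasible VV p τ V ∧ s = ∫ μ, V μ ∂(τ : Measure (Belief Ω))}

/-- The sender's optimal value under cheap talk, `𝒱_CT(p)`. -/
def cheapTalkValue (VV : Belief Ω → Set ℝ) (p : Belief Ω) : ℝ :=
  sSup {s | ∃ τ V, CheapTalkFeasible VV p τ V ∧ s = ∫ μ, V μ ∂(τ : Measure (Belief Ω))}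

/-- The quasiconcave envelope of the correspondence `𝐕` at `p`: the pointwise infimum over all
quasiconcave functions on the simplex that majorize `max 𝐕`. -/
def quasiconcaveEnvelope (VV : Belief Ω → Set ℝ) (p : Belief Ω) : ℝ :=
  sInf {y | ∃ f : (Ω → ℝ) → ℝ, QuasiconcaveOn ℝ (stdSimplex ℝ Ω) f ∧
    (∀ μ : Belief Ω, upperEnvelope VV μ ≤ f μ) ∧ y = f p}

/-- No disclosure, whose best value to the sender is `max 𝐕(p)`, is suboptimal under
cheap talk. -/
def NoDisclosureSuboptimal (VV : Belief Ω → Set ℝ) (p : Belief Ω) : Prop :=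
  upperEnvelope VV p < cheapTalkValue VV p

/-- The shifted correspondence `x ↦ 𝐕(μ) - c` on `[0, 1]`, where `x` is the probability
that `μ` gives to the state `ω₁`; with two states, `x` determines `μ`. -/
def shiftedCorrespondence (VV : Belief Ω → Set ℝ) (ω₁ : Ω) (c : ℝ)
    (x : Set.Icc (0 : ℝ) 1) : Set ℝ :=
  {y | ∃ μ : Belief Ω, (μ : Ω → ℝ) ω₁ = x ∧ ∃ v ∈ VV μ, y = v - c}

end Communication

end MediatedCommunication

end

open MeasureTheory

noncomputable section

namespace MediatedCommunication

/-! Write `q` for the quasiconcave envelope at `p`. With two states beliefs form an interval, and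
`q` is the largest level that `max 𝐕` reaches on both sides of `p`. Since `max 𝐕(p) < q`,
connectedness gives a belief on each side with `q ∈ 𝐕`; splitting `p` between them shows that cheap
talk is worth exactly `q` (`cheapTalkValue_eq`). The question becomes whether some mediation plan
beats `q`.

If `𝐕 - q` is mono-crossing, there is either nothing above `q` or a threshold `t` strictly beyond
`p`, in a suitable orientation, with `(V - q)(μ - t) ≥ 0`. Zero covariance turns the expectation of
this product into `(∫ V - q)(p - t)`, so `∫ V ≤ q` (`MediationFeasible.integral_le_of_crossing`).

Conversely, `max 𝐕` can exceed `q` on one side of `p` only. If mono-crossing fails, that side has a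
belief with a value below `q` and, nearer to `p`, one with a value above `q`. Mixing both with a
belief of value `q` across `p` and balancing the covariance gives the nearer one enough weight for a
mean above `q` (`exists_mediationFeasible_lt`). -/

/-- A correspondence on beliefs whose values are non-empty compact intervals, with upper
semicontinuous maximum, lower semicontinuous minimum, and uniformly bounded values. -/
structure IsIntervalCorrespondence {Ω : Type*} [Fintype Ω] (VV : Belief Ω → Set ℝ) : Prop where
  eq_Icc : ∀ μ, VV μ = Set.Icc (lowerEnvelope VV μ) (upperEnvelope VV μ)
  lower_le_upper : ∀ μ, lowerEnvelope VV μ ≤ upperEnvelope VV μ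
  isClosed_upper : ∀ c, IsClosed {μ | c ≤ upperEnvelope VV μ}
  isClosed_lower : ∀ c, IsClosed {μ | lowerEnvelope VV μ ≤ c}
  bounded : ∃ B, ∀ μ, ∀ v ∈ VV μ, |v| ≤ B

/-! ### Regularity of the value correspondence -/

section BestResponses

variable {Ω A : Type*} [Fintype Ω] [MetricSpace A]

lemma continuous_receiverPayoff {uR : Ω → A → ℝ} (huR : ∀ ω, Continuous (uR ω)) :
    Continuous fun q : Belief Ω × A => receiverPayoff uR q.1 q.2 := by
  unfold receiverPayoff
  refine continuous_finsetSum _ fun ω _ => ?_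
  exact ((continuous_apply ω).comp (continuous_subtype_val.comp continuous_fst)).mul
    ((huR ω).comp continuous_snd)

lemma isClosed_graph_bestResponses {uR : Ω → A → ℝ} (huR : ∀ ω, Continuous (uR ω)) :
    IsClosed {q : Belief Ω × A | q.2 ∈ bestResponses uR q.1} := by
  have : {q : Belief Ω × A | q.2 ∈ bestResponses uR q.1} =
      ⋂ a', {q | receiverPayoff uR q.1 a' ≤ receiverPayoff uR q.1 q.2} := by
    ext q; simp [bestResponses]
  rw [this]
  refine isClosed_iInter fun a' => isClosed_le ?_ (continuous_receiverPayoff huR)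
  exact (continuous_receiverPayoff huR).comp (continuous_fst.prodMk continuous_const)

variable [CompactSpace A]

lemma isCompact_bestResponses {uR : Ω → A → ℝ} (huR : ∀ ω, Continuous (uR ω)) (μ : Belief Ω) :
    IsCompact (bestResponses uR μ) :=
  ((isClosed_graph_bestResponses huR).preimage
    (continuous_const.prodMk continuous_id : Continuous fun a : A => (μ, a))).isCompact

lemma bestResponses_nonempty [Nonempty A] {uR : Ω → A → ℝ} (huR : ∀ ω, Continuous (uR ω))
    (μ : Belief Ω) : (bestResponses uR μ).Nonempty := by
  have hc : Continuous (receiverPayoff uR μ) :=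
    (continuous_receiverPayoff huR).comp (continuous_const.prodMk continuous_id)
  obtain ⟨a, -, ha⟩ := isCompact_univ.exists_isMaxOn Set.univ_nonempty hc.continuousOn
  exact ⟨a, fun a' => ha (Set.mem_univ a')⟩

lemma exists_valueCorrespondence_eq_Icc [Nonempty A] {uS : A → ℝ} (huS : Continuous uS)
    {uR : Ω → A → ℝ} (huR : ∀ ω, Continuous (uR ω)) (μ : Belief Ω) :
    ∃ b ∈ bestResponses uR μ, ∃ a ∈ bestResponses uR μ,
      (∀ c ∈ bestResponses uR μ, uS b ≤ uS c ∧ uS c ≤ uS a) ∧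
        valueCorrespondence uS uR μ = Set.Icc (uS b) (uS a) := by
  obtain ⟨a, ha, hamax⟩ := (isCompact_bestResponses huR μ).exists_isMaxOn
    (bestResponses_nonempty huR μ) huS.continuousOn
  obtain ⟨b, hb, hbmin⟩ := (isCompact_bestResponses huR μ).exists_isMinOn
    (bestResponses_nonempty huR μ) huS.continuousOn
  refine ⟨b, hb, a, ha, fun c hc => ⟨hbmin hc, hamax hc⟩, Set.Subset.antisymm ?_ ?_⟩
  · refine convexHull_min ?_ (convex_Icc _ _)
    rintro _ ⟨c, hc, rfl⟩
    exact ⟨hbmin hc, hamax hc⟩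
  · rw [← segment_eq_Icc (hbmin ha)]
    exact segment_subset_convexHull (Set.mem_image_of_mem _ hb) (Set.mem_image_of_mem _ ha)

/-- Berge's theorem in level-set form: each level set is the projection, along the compact `A`, of a
closed part of the best-response graph. -/
lemma isIntervalCorrespondence_valueCorrespondence [Nonempty A] {uS : A → ℝ}
    (huS : Continuous uS) {uR : Ω → A → ℝ} (huR : ∀ ω, Continuous (uR ω)) :
    IsIntervalCorrespondence (valueCorrespondence uS uR) where
  eq_Icc μ := by
    obtain ⟨b, hb, a, ha, h, e⟩ := exists_valueCorrespondence_eq_Icc huS huR μ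
    rw [lowerEnvelope, upperEnvelope, e, csSup_Icc (h a ha).1, csInf_Icc (h a ha).1]
  lower_le_upper μ := by
    obtain ⟨b, hb, a, ha, h, e⟩ := exists_valueCorrespondence_eq_Icc huS huR μ
    rw [lowerEnvelope, upperEnvelope, e, csSup_Icc (h a ha).1, csInf_Icc (h a ha).1]
    exact (h a ha).1
  isClosed_upper c := by
    have : {μ | c ≤ upperEnvelope (valueCorrespondence uS uR) μ} = Prod.fst ''
        ({q : Belief Ω × A | q.2 ∈ bestResponses uR q.1} ∩ {q | c ≤ uS q.2}) := by
      ext μ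
      obtain ⟨b, hb, a, ha, h, e⟩ := exists_valueCorrespondence_eq_Icc huS huR μ
      rw [Set.mem_ofPred_eq, upperEnvelope, e, csSup_Icc (h a ha).1]
      constructor
      · exact fun hc => ⟨(μ, a), ⟨ha, hc⟩, rfl⟩
      · rintro ⟨⟨_, a'⟩, ⟨ha', hc⟩, rfl⟩
        exact le_trans hc (h a' ha').2
    rw [this]
    exact isClosedMap_fst_of_compactSpace _ ((isClosed_graph_bestResponses huR).inter
      (isClosed_le continuous_const (huS.comp continuous_snd)))
  isClosed_lower c := by
    have : {μ | lowerEnvelope (valueCorrespondence uS uR) μ ≤ c} = Prod.fst ''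
        ({q : Belief Ω × A | q.2 ∈ bestResponses uR q.1} ∩ {q | uS q.2 ≤ c}) := by
      ext μ
      obtain ⟨b, hb, a, ha, h, e⟩ := exists_valueCorrespondence_eq_Icc huS huR μ
      rw [Set.mem_ofPred_eq, lowerEnvelope, e, csInf_Icc (h a ha).1]
      constructor
      · exact fun hc => ⟨(μ, b), ⟨hb, hc⟩, rfl⟩
      · rintro ⟨⟨_, a'⟩, ⟨ha', hc⟩, rfl⟩
        exact le_trans (h a' ha').1 hc
    rw [this]
    exact isClosedMap_fst_of_compactSpace _ ((isClosed_graph_bestResponses huR).inter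
      (isClosed_le (huS.comp continuous_snd) continuous_const))
  bounded := by
    obtain ⟨B, hB⟩ := isCompact_univ.exists_bound_of_continuousOn huS.continuousOn
    refine ⟨B, fun μ v hv => ?_⟩
    obtain ⟨b, hb, a, ha, h, e⟩ := exists_valueCorrespondence_eq_Icc huS huR μ
    rw [e] at hv
    have h1 := abs_le.1 (hB a trivial)
    have h2 := abs_le.1 (hB b trivial)
    exact abs_le.2 ⟨h2.1.trans hv.1, hv.2.trans h1.2⟩

end BestResponses

namespace IsIntervalCorrespondence

variable {Ω : Type*} [Fintype Ω] {VV : Belief Ω → Set ℝ}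

lemma upper_mem (hV : IsIntervalCorrespondence VV) (μ : Belief Ω) : upperEnvelope VV μ ∈ VV μ := by
  rw [hV.eq_Icc]; exact ⟨hV.lower_le_upper μ, le_rfl⟩

lemma lower_mem (hV : IsIntervalCorrespondence VV) (μ : Belief Ω) : lowerEnvelope VV μ ∈ VV μ := by
  rw [hV.eq_Icc]; exact ⟨le_rfl, hV.lower_le_upper μ⟩

lemma le_upper (hV : IsIntervalCorrespondence VV) {μ : Belief Ω} {v : ℝ} (hv : v ∈ VV μ) :
    v ≤ upperEnvelope VV μ := by
  rw [hV.eq_Icc] at hv; exact hv.2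

lemma lower_le (hV : IsIntervalCorrespondence VV) {μ : Belief Ω} {v : ℝ} (hv : v ∈ VV μ) :
    lowerEnvelope VV μ ≤ v := by
  rw [hV.eq_Icc] at hv; exact hv.1

lemma isMeasurableSelection_upper (hV : IsIntervalCorrespondence VV) :
    IsMeasurableSelection VV (upperEnvelope VV) :=
  ⟨measurable_of_Ici fun c => (hV.isClosed_upper c).measurableSet, hV.upper_mem⟩

/-- Intermediate values: if `𝐕` reaches `c` from above somewhere on a side of `p` and stays
below `c` at `p`, then it takes the value `c` on that side. -/
lemma exists_mem_of_upper_lt (hV : IsIntervalCorrespondence VV) {p x : Belief Ω} {ω : Ω} {c : ℝ}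
    (hx : (x : Ω → ℝ) ω ≤ (p : Ω → ℝ) ω) (hcx : c ≤ upperEnvelope VV x)
    (hpc : upperEnvelope VV p < c) :
    ∃ z : Belief Ω, (z : Ω → ℝ) ω ≤ (p : Ω → ℝ) ω ∧ z ≠ p ∧ c ∈ VV z := by
  have hconv : Convex ℝ (stdSimplex ℝ Ω ∩ {y : Ω → ℝ | y ω ≤ (p : Ω → ℝ) ω}) :=
    (convex_stdSimplex ℝ Ω).inter
      (convex_halfSpace_le (LinearMap.proj (R := ℝ) (φ := fun _ : Ω => ℝ) ω).isLinear _)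
  have hpre : IsPreconnected {y : Belief Ω | (y : Ω → ℝ) ω ≤ (p : Ω → ℝ) ω} := by
    rw [← Topology.IsInducing.subtypeVal.isPreconnected_image]
    convert hconv.isPreconnected using 1
    ext y
    constructor
    · rintro ⟨y, hy, rfl⟩
      exact ⟨y.2, hy⟩
    · rintro ⟨h1, h2⟩
      exact ⟨⟨y, h1⟩, h2, rfl⟩
  -- The closed sets `c ≤ max 𝐕` and `min 𝐕 ≤ c` cover the connected half-simplex and both meet it,
  -- so they intersect there.
  obtain ⟨z, hz, hz1, hz2⟩ := isPreconnected_closed_iff.1 hpre _ _ (hV.isClosed_upper c)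
    (hV.isClosed_lower c)
    (fun y _ => by
      rcases le_total c (upperEnvelope VV y) with h | h
      · exact Or.inl h
      · exact Or.inr ((hV.lower_le_upper y).trans h))
    ⟨x, hx, hcx⟩ ⟨p, le_refl ((p : Ω → ℝ) ω), (hV.lower_le_upper p).trans hpc.le⟩
  refine ⟨z, hz, ?_, ?_⟩
  · rintro rfl
    exact absurd hz1 (not_le.2 hpc)
  · rw [hV.eq_Icc]
    exact ⟨hz2, hz1⟩

end IsIntervalCorrespondence

/-! ### The quasiconcave envelope -/

section Envelope

variable {Ω : Type*} [Fintype Ω] {VV : Belief Ω → Set ℝ}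

lemma quasiconcaveOn_step (ω : Ω) (t m B : ℝ) (hmB : m ≤ B) :
    QuasiconcaveOn ℝ (stdSimplex ℝ Ω) fun y : Ω → ℝ => if y ω ≤ t then m else B := by
  intro r
  have key (y : Ω → ℝ) : (r ≤ if y ω ≤ t then m else B) ↔ (t < y ω ∧ r ≤ B) ∨ r ≤ m := by
    split_ifs with h
    · simp [not_lt.2 h]
    · exact ⟨fun hr => Or.inl ⟨not_le.1 h, hr⟩, fun hr => hr.elim (·.2) fun h => h.trans hmB⟩
  simp only [key]
  by_cases h1 : r ≤ m
  · simpa [h1] using convex_stdSimplex ℝ Ω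
  · by_cases h2 : r ≤ B
    · simp only [h1, h2, and_true, or_false]
      exact (convex_stdSimplex ℝ Ω).inter
        (convex_halfSpace_gt (LinearMap.proj (R := ℝ) (φ := fun _ : Ω => ℝ) ω).isLinear _)
    · simp [h1, h2, convex_empty]

lemma bddBelow_majorants (VV : Belief Ω → Set ℝ) (p : Belief Ω) :
    BddBelow {y | ∃ f : (Ω → ℝ) → ℝ, QuasiconcaveOn ℝ (stdSimplex ℝ Ω) f ∧
      (∀ μ : Belief Ω, upperEnvelope VV μ ≤ f μ) ∧ y = f p} := by
  refine ⟨upperEnvelope VV p, ?_⟩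
  rintro _ ⟨f, -, hf, rfl⟩
  exact hf p

/-- On each side of `p`, the maximum of `𝐕` reaches its quasiconcave envelope at `p`. -/
lemma IsIntervalCorrespondence.exists_envelope_le_upper (hV : IsIntervalCorrespondence VV)
    (p : Belief Ω) (ω : Ω) :
    ∃ x : Belief Ω, (x : Ω → ℝ) ω ≤ (p : Ω → ℝ) ω ∧
      quasiconcaveEnvelope VV p ≤ upperEnvelope VV x := by
  have hK : IsCompact {y : Belief Ω | (y : Ω → ℝ) ω ≤ (p : Ω → ℝ) ω} :=
    (isClosed_le ((continuous_apply ω).comp continuous_subtype_val) continuous_const).isCompact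
  have husc : UpperSemicontinuous (upperEnvelope VV) :=
    upperSemicontinuous_iff_isClosed_preimage.2 hV.isClosed_upper
  obtain ⟨x, hx, hmax⟩ := (husc.upperSemicontinuousOn _).exists_isMaxOn ⟨p, le_refl ((p : Ω → ℝ) ω)⟩ hK
  refine ⟨x, hx, csInf_le (bddBelow_majorants VV p) ?_⟩
  obtain ⟨B, hB⟩ := hV.bounded
  have hB' : ∀ μ, upperEnvelope VV μ ≤ B := fun μ => (abs_le.1 (hB μ _ (hV.upper_mem μ))).2
  -- The test majorant equals the maximum of `max 𝐕` over the side containing `p`, and the global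
  -- bound `B` elsewhere.
  refine ⟨_, quasiconcaveOn_step ω ((p : Ω → ℝ) ω) (upperEnvelope VV x) B (hB' x), fun μ => ?_, ?_⟩
  · split_ifs with h
    · exact hmax h
    · exact hB' μ
  · simp

end Envelope

/-! ### Beliefs over two states as an interval -/

section TwoStates

variable {Ω : Type*} [Fintype Ω] {ω₁ ω₂ : Ω}

lemma exists_ne_and_forall_eq_or_eq (hΩ : Fintype.card Ω = 2) (ω : Ω) :
    ∃ ω', ω ≠ ω' ∧ ∀ o, o = ω ∨ o = ω' := by
  rw [← Nat.card_eq_fintype_card, Nat.card_eq_two_iff' ω] at hΩ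
  obtain ⟨ω', hne, h⟩ := hΩ
  exact ⟨ω', hne.symm, fun o => or_iff_not_imp_left.2 (h o)⟩

lemma Belief.add_eq_one (hne : ω₁ ≠ ω₂) (hall : ∀ o, o = ω₁ ∨ o = ω₂) (μ : Belief Ω) :
    (μ : Ω → ℝ) ω₁ + (μ : Ω → ℝ) ω₂ = 1 := by
  classical
  rw [← μ.2.2, ← Finset.sum_pair hne]
  refine Finset.sum_congr ?_ fun _ _ => rfl
  ext o
  simpa using hall o

lemma Belief.ext_apply (hne : ω₁ ≠ ω₂) (hall : ∀ o, o = ω₁ ∨ o = ω₂) {μ ν : Belief Ω}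
    (h : (μ : Ω → ℝ) ω₁ = (ν : Ω → ℝ) ω₁) : μ = ν := by
  have h1 := Belief.add_eq_one hne hall μ
  have h2 := Belief.add_eq_one hne hall ν
  ext o
  rcases hall o with rfl | rfl
  · exact h
  · linarith

lemma Belief.exists_apply_eq (hne : ω₁ ≠ ω₂) (hall : ∀ o, o = ω₁ ∨ o = ω₂) {x : ℝ}
    (hx : x ∈ Set.Icc (0 : ℝ) 1) : ∃ μ : Belief Ω, (μ : Ω → ℝ) ω₁ = x := by
  classical
  refine ⟨⟨fun o => if o = ω₁ then x else 1 - x, show _ ∧ _ from ⟨fun o => ?_, ?_⟩⟩, if_pos rfl⟩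
  · dsimp only
    split_ifs
    · exact hx.1
    · linarith [hx.2]
  · have : (Finset.univ : Finset Ω) = {ω₁, ω₂} := by
      ext o
      simpa using hall o
    rw [this, Finset.sum_pair hne]
    simp [hne.symm]

/-- A quasiconcave majorant is at least any value reached by `max 𝐕` on both sides of `p`. -/
lemma le_quasiconcaveEnvelope {VV : Belief Ω → Set ℝ} (hV : IsIntervalCorrespondence VV)
    (hne : ω₁ ≠ ω₂) (hall : ∀ o, o = ω₁ ∨ o = ω₂) {p x y : Belief Ω} {k : ℝ}
    (hx : (x : Ω → ℝ) ω₁ ≤ (p : Ω → ℝ) ω₁) (hy : (p : Ω → ℝ) ω₁ ≤ (y : Ω → ℝ) ω₁)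
    (hkx : k ≤ upperEnvelope VV x) (hky : k ≤ upperEnvelope VV y) :
    k ≤ quasiconcaveEnvelope VV p := by
  obtain ⟨B, hB⟩ := hV.bounded
  -- The constant `B` is a majorant, so the infimum is over a non-empty set.
  refine le_csInf ⟨B, fun _ => B, fun r => ?_, fun μ => (abs_le.1 (hB μ _ (hV.upper_mem μ))).2,
    rfl⟩ ?_
  · by_cases hr : r ≤ B
    · simpa [hr] using convex_stdSimplex ℝ Ω
    · simp [hr, convex_empty]
  rintro _ ⟨f, hf, hmaj, rfl⟩
  have hseg : (p : Ω → ℝ) ∈ segment ℝ (x : Ω → ℝ) (y : Ω → ℝ) := by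
    have hmem : (p : Ω → ℝ) ω₁ ∈ segment ℝ ((x : Ω → ℝ) ω₁) ((y : Ω → ℝ) ω₁) := by
      rw [segment_eq_Icc (hx.trans hy)]; exact ⟨hx, hy⟩
    obtain ⟨a, b, ha, hb, hab, e⟩ := hmem
    refine ⟨a, b, ha, hb, hab, ?_⟩
    have h1 := Belief.add_eq_one hne hall x
    have h2 := Belief.add_eq_one hne hall y
    have h3 := Belief.add_eq_one hne hall p
    simp only [smul_eq_mul] at e
    funext o
    simp only [Pi.add_apply, Pi.smul_apply, smul_eq_mul]
    rcases hall o with rfl | rfl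
    · exact e
    · linear_combination a * h1 + b * h2 - h3 + hab - e
  exact ((hf k).segment_subset ⟨x.2, hkx.trans (hmaj x)⟩ ⟨y.2, hky.trans (hmaj y)⟩ hseg).2

end TwoStates

/-! ### Finitely supported plans -/

section FiniteSupport

variable {Ω : Type*} [Fintype Ω]

/-- The distribution of beliefs with weights `w` on the points `x`. -/
lemma exists_finitely_supported_distribution {ι : Type*} [Fintype ι] (w : ι → ℝ)
    (hw : ∀ i, 0 ≤ w i) (hsum : ∑ i, w i = 1) (x : ι → Belief Ω) :
    ∃ τ : ProbabilityMeasure (Belief Ω),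
      (∀ f : Belief Ω → ℝ, ∫ μ, f μ ∂(τ : Measure (Belief Ω)) = ∑ i, w i * f (x i)) ∧
        ∀ μ ∈ (τ : Measure (Belief Ω)).support, ∃ i, x i = μ := by
  let m : Measure (Belief Ω) := ∑ i, ENNReal.ofReal (w i) • Measure.dirac (x i)
  have hm : IsProbabilityMeasure m := by
    constructor
    simp only [m, Measure.finsetSum_apply, Measure.smul_apply, measure_univ, smul_eq_mul, mul_one]
    rw [← ENNReal.ofReal_sum_of_nonneg fun i _ => hw i, hsum, ENNReal.ofReal_one]
  refine ⟨⟨m, hm⟩, fun f => ?_, fun μ hμ => ?_⟩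
  · change ∫ μ, f μ ∂m = _
    have hint : ∀ i ∈ Finset.univ, Integrable f (ENNReal.ofReal (w i) • Measure.dirac (x i)) :=
      fun i _ => (integrable_dirac (by simp)).smul_measure ENNReal.ofReal_ne_top
    rw [integral_finsetSum_measure hint]
    refine Finset.sum_congr rfl fun i _ => ?_
    rw [integral_smul_measure, integral_dirac, ENNReal.toReal_ofReal (hw i), smul_eq_mul]
  · by_contra! h
    refine (Measure.notMem_support_iff_exists.2 ⟨(Set.range x)ᶜ, ?_, ?_⟩) hμ
    · exact (Set.finite_range x).isClosed.isOpen_compl.mem_nhds (by simpa using h)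
    · change m _ = 0
      simp only [m, Measure.finsetSum_apply, Measure.smul_apply, smul_eq_mul]
      refine Finset.sum_eq_zero fun i _ => ?_
      rw [Measure.dirac_apply' _ (Set.finite_range x).measurableSet.compl]
      simp

/-- Singletons are measurable, so values at the atoms of a finite plan can be prescribed one at a
time. -/
lemma IsMeasurableSelection.update {VV : Belief Ω → Set ℝ} {V : Belief Ω → ℝ}
    (hV : IsMeasurableSelection VV V) {x : Belief Ω} {v : ℝ} (hv : v ∈ VV x) :
    ∃ W, IsMeasurableSelection VV W ∧ W x = v ∧ ∀ y ≠ x, W y = V y := by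
  classical
  refine ⟨fun y => if y = x then v else V y,
    ⟨Measurable.ite (measurableSet_singleton x) measurable_const hV.1, fun y => ?_⟩,
    if_pos rfl, fun y hy => if_neg hy⟩
  dsimp only
  split_ifs with h
  · exact h ▸ hv
  · exact hV.2 y

end FiniteSupport

/-! ### Feasible plans and the value of cheap talk -/

section Feasibility

variable {Ω : Type*} [Fintype Ω] {VV : Belief Ω → Set ℝ} {p : Belief Ω}
  {τ : ProbabilityMeasure (Belief Ω)} {V : Belief Ω → ℝ}

lemma memLp_apply (τ : ProbabilityMeasure (Belief Ω)) (ω : Ω) (r : ENNReal) :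
    MemLp (fun μ : Belief Ω => (μ : Ω → ℝ) ω) r (τ : Measure (Belief Ω)) := by
  refine MemLp.of_bound
    ((continuous_apply ω).comp continuous_subtype_val).measurable.aestronglyMeasurable 1
    (Filter.Eventually.of_forall fun μ => ?_)
  rw [Real.norm_eq_abs, abs_of_nonneg (show 0 ≤ (μ : Ω → ℝ) ω from μ.2.1 ω)]
  exact (mem_Icc_of_mem_stdSimplex μ.2 ω).2

lemma IsMeasurableSelection.memLp (hV : IsIntervalCorrespondence VV)
    (hsel : IsMeasurableSelection VV V) (τ : ProbabilityMeasure (Belief Ω)) (r : ENNReal) :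
    MemLp V r (τ : Measure (Belief Ω)) := by
  obtain ⟨B, hB⟩ := hV.bounded
  exact MemLp.of_bound hsel.1.aestronglyMeasurable B
    (Filter.Eventually.of_forall fun μ => hB μ _ (hsel.2 μ))

lemma zeroCov_iff (hV : IsIntervalCorrespondence VV) (hsel : IsMeasurableSelection VV V)
    (hp : BayesPlausible p τ) :
    ZeroCov τ V ↔ ∀ ω, ∫ μ, V μ * (μ : Ω → ℝ) ω ∂(τ : Measure (Belief Ω)) =
      (∫ μ, V μ ∂(τ : Measure (Belief Ω))) * (p : Ω → ℝ) ω := by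
  refine forall_congr' fun ω => ?_
  rw [ProbabilityTheory.covariance_eq_sub (hsel.memLp hV τ 2) (memLp_apply τ ω 2), hp ω,
    sub_eq_zero]
  rfl

lemma bddAbove_mediation (hV : IsIntervalCorrespondence VV) (p : Belief Ω) :
    BddAbove {s | ∃ τ V, MediationFeasible VV p τ V ∧
      s = ∫ μ, V μ ∂(τ : Measure (Belief Ω))} := by
  obtain ⟨B, hB⟩ := hV.bounded
  refine ⟨B, ?_⟩
  rintro _ ⟨τ, V, hf, rfl⟩
  calc ∫ μ, V μ ∂(τ : Measure (Belief Ω)) ≤ ∫ _, B ∂(τ : Measure (Belief Ω)) :=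
        integral_mono ((hf.1.memLp hV τ 1).integrable le_rfl) (integrable_const _)
          fun μ => (abs_le.1 (hB μ _ (hf.1.2 μ))).2
    _ = B := by simp

lemma CheapTalkFeasible.ae_eq_const (h : CheapTalkFeasible VV p τ V) :
    ∃ c, (∀ μ ∈ (τ : Measure (Belief Ω)).support, V μ = c) ∧
      V =ᵐ[(τ : Measure (Belief Ω))] fun _ => c := by
  obtain ⟨c, hc⟩ := h.2.2
  exact ⟨c, hc, Filter.mem_of_superset Measure.support_mem_ae hc⟩

lemma CheapTalkFeasible.mediationFeasible (hV : IsIntervalCorrespondence VV)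
    (h : CheapTalkFeasible VV p τ V) : MediationFeasible VV p τ V := by
  obtain ⟨c, -, hc⟩ := h.ae_eq_const
  refine ⟨h.1, h.2.1, (zeroCov_iff hV h.1 h.2.1).2 fun ω => ?_⟩
  rw [integral_congr_ae hc, ← h.2.1 ω,
    integral_congr_ae (g := fun μ : Belief Ω => c * (μ : Ω → ℝ) ω) (hc.mono fun μ hμ => by
      simp only [hμ]), integral_const_mul]
  simp

variable {ω₁ ω₂ : Ω}

/-- As the mean belief is `p`, the support has a point on each side of `p`, and `max 𝐕` reaches the
constant value at both. -/
lemma CheapTalkFeasible.integral_le (hV : IsIntervalCorrespondence VV) (hne : ω₁ ≠ ω₂)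
    (hall : ∀ o, o = ω₁ ∨ o = ω₂) (h : CheapTalkFeasible VV p τ V) :
    ∫ μ, V μ ∂(τ : Measure (Belief Ω)) ≤ quasiconcaveEnvelope VV p := by
  obtain ⟨c, hc, hae⟩ := h.ae_eq_const
  rw [integral_congr_ae hae]
  simp only [integral_const, probReal_univ, one_smul]
  have key : ∀ ω, ∃ x : Belief Ω, (x : Ω → ℝ) ω ≤ (p : Ω → ℝ) ω ∧ c ≤ upperEnvelope VV x := by
    intro ω
    obtain ⟨x, hx, hle⟩ := exists_notMem_null_le_integral
      ((memLp_apply τ ω 1).integrable le_rfl)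
      (Measure.measure_compl_support (μ := (τ : Measure (Belief Ω))))
    rw [h.2.1 ω] at hle
    exact ⟨x, hle, hc x (Set.notMem_compl_iff.1 hx) ▸ hV.le_upper (h.1.2 x)⟩
  obtain ⟨x, hx, hcx⟩ := key ω₁
  obtain ⟨y, hy, hcy⟩ := key ω₂
  have h1 := Belief.add_eq_one hne hall y
  have h2 := Belief.add_eq_one hne hall p
  exact le_quasiconcaveEnvelope hV hne hall hx (by linarith) hcx hcy

lemma exists_mem_quasiconcaveEnvelope (hV : IsIntervalCorrespondence VV) (hne : ω₁ ≠ ω₂)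
    (hall : ∀ o, o = ω₁ ∨ o = ω₂)
    (hp : upperEnvelope VV p < quasiconcaveEnvelope VV p) :
    ∃ z : Belief Ω, (z : Ω → ℝ) ω₁ < (p : Ω → ℝ) ω₁ ∧ quasiconcaveEnvelope VV p ∈ VV z := by
  obtain ⟨x, hx, hqx⟩ := hV.exists_envelope_le_upper p ω₁
  obtain ⟨z, hz, hzp, hqz⟩ := hV.exists_mem_of_upper_lt hx hqx hp
  exact ⟨z, lt_of_le_of_ne hz fun h => hzp (Belief.ext_apply hne hall h), hqz⟩

/-- With two states, the quasiconcave envelope is attained by cheap talk when it exceeds the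
value of no disclosure. -/
lemma exists_cheapTalkFeasible (hV : IsIntervalCorrespondence VV) (hne : ω₁ ≠ ω₂)
    (hall : ∀ o, o = ω₁ ∨ o = ω₂)
    (hp : upperEnvelope VV p < quasiconcaveEnvelope VV p) :
    ∃ τ V, CheapTalkFeasible VV p τ V ∧
      quasiconcaveEnvelope VV p = ∫ μ, V μ ∂(τ : Measure (Belief Ω)) := by
  obtain ⟨x, hx, hqx⟩ := exists_mem_quasiconcaveEnvelope hV hne hall hp
  obtain ⟨y, hy, hqy⟩ := exists_mem_quasiconcaveEnvelope hV hne.symm (fun o => (hall o).symm) hp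
  have hx1 := Belief.add_eq_one hne hall x
  have hy1 := Belief.add_eq_one hne hall y
  have hp1 := Belief.add_eq_one hne hall p
  have hxy : (x : Ω → ℝ) ω₁ < (y : Ω → ℝ) ω₁ := by linarith
  obtain ⟨W, hW, hWx, -⟩ := hV.isMeasurableSelection_upper.update hqx
  obtain ⟨V, hVs, hVy, hVW⟩ := hW.update hqy
  have hVx : V x = quasiconcaveEnvelope VV p := by
    rw [hVW x (by rintro rfl; exact lt_irrefl _ hxy), hWx]
  have hd : (y : Ω → ℝ) ω₁ - (x : Ω → ℝ) ω₁ ≠ 0 := by linarith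
  set a := ((y : Ω → ℝ) ω₁ - (p : Ω → ℝ) ω₁) / ((y : Ω → ℝ) ω₁ - (x : Ω → ℝ) ω₁) with ha
  set b := ((p : Ω → ℝ) ω₁ - (x : Ω → ℝ) ω₁) / ((y : Ω → ℝ) ω₁ - (x : Ω → ℝ) ω₁) with hb
  have hab : a + b = 1 := by rw [ha, hb]; field_simp; ring
  have ha0 : 0 ≤ a := div_nonneg (by linarith) (by linarith)
  have hb0 : 0 ≤ b := div_nonneg (by linarith) (by linarith)
  have hmean : a * (x : Ω → ℝ) ω₁ + b * (y : Ω → ℝ) ω₁ = (p : Ω → ℝ) ω₁ := by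
    rw [ha, hb]; field_simp; ring
  obtain ⟨τ, hτ, hsupp⟩ := exists_finitely_supported_distribution ![a, b]
    (by simp [Fin.forall_fin_two, ha0, hb0]) (by simpa using hab) ![x, y]
  refine ⟨τ, V, ⟨hVs, fun ω => ?_, quasiconcaveEnvelope VV p, fun μ hμ => ?_⟩, ?_⟩
  · rw [hτ]
    simp only [Fin.sum_univ_two, Matrix.cons_val_zero, Matrix.cons_val_one]
    rcases hall ω with rfl | rfl
    · exact hmean
    · linear_combination a * hx1 + b * hy1 - hp1 + hab - hmean
  · obtain ⟨i, rfl⟩ := hsupp μ hμ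
    fin_cases i
    · exact hVx
    · exact hVy
  · rw [hτ]
    simp only [Fin.sum_univ_two, Matrix.cons_val_zero, Matrix.cons_val_one, hVx, hVy]
    rw [← add_mul, hab, one_mul]

lemma NoDisclosureSuboptimal.upper_lt (hV : IsIntervalCorrespondence VV) (hne : ω₁ ≠ ω₂)
    (hall : ∀ o, o = ω₁ ∨ o = ω₂) (h : NoDisclosureSuboptimal VV p) :
    upperEnvelope VV p < quasiconcaveEnvelope VV p := by
  refine lt_of_lt_of_le h (csSup_le ?_ ?_)
  -- No disclosure is itself a cheap talk plan, so the supremum is over a non-empty set.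
  · obtain ⟨τ, hτ, hs⟩ := exists_finitely_supported_distribution ![(1 : ℝ)] (by simp) (by simp)
      ![p]
    refine ⟨_, τ, upperEnvelope VV, ⟨hV.isMeasurableSelection_upper, fun ω => ?_,
      upperEnvelope VV p, fun μ hμ => ?_⟩, rfl⟩
    · rw [hτ]; simp
    · obtain ⟨i, rfl⟩ := hs μ hμ
      simp
  · rintro _ ⟨τ, V, hf, rfl⟩
    exact hf.integral_le hV hne hall

lemma cheapTalkValue_eq (hV : IsIntervalCorrespondence VV) (hne : ω₁ ≠ ω₂)
    (hall : ∀ o, o = ω₁ ∨ o = ω₂)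
    (hp : upperEnvelope VV p < quasiconcaveEnvelope VV p) :
    cheapTalkValue VV p = quasiconcaveEnvelope VV p := by
  refine IsGreatest.csSup_eq ⟨exists_cheapTalkFeasible hV hne hall hp, ?_⟩
  rintro _ ⟨τ, V, hf, rfl⟩
  exact hf.integral_le hV hne hall

/-- Cheap talk plans are mediation plans and one of them attains the envelope, so only the upper
bound is at stake. -/
lemma mediationValue_eq_iff (hV : IsIntervalCorrespondence VV) (hne : ω₁ ≠ ω₂)
    (hall : ∀ o, o = ω₁ ∨ o = ω₂)
    (hp : upperEnvelope VV p < quasiconcaveEnvelope VV p) :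
    mediationValue VV p = quasiconcaveEnvelope VV p ↔
      ∀ τ V, MediationFeasible VV p τ V →
        ∫ μ, V μ ∂(τ : Measure (Belief Ω)) ≤ quasiconcaveEnvelope VV p := by
  constructor
  · intro h τ V hf
    rw [← h]
    exact le_csSup (bddAbove_mediation hV p) ⟨τ, V, hf, rfl⟩
  · intro h
    obtain ⟨τ, V, hf, e⟩ := exists_cheapTalkFeasible hV hne hall hp
    refine IsGreatest.csSup_eq ⟨⟨τ, V, hf.mediationFeasible hV, e⟩, ?_⟩
    rintro _ ⟨τ, V, hf, rfl⟩
    exact h τ V hf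

/-! ### Mono-crossing bounds mediation -/

/-- If the selections of `𝐕` cross the level `c` at a single point beyond the prior, then
mediation cannot yield more than `c`. -/
lemma MediationFeasible.integral_le_of_crossing (hV : IsIntervalCorrespondence VV)
    (hf : MediationFeasible VV p τ V) {ω : Ω} {c t : ℝ} (ht : (p : Ω → ℝ) ω < t)
    (hcross : ∀ μ : Belief Ω, ∀ v ∈ VV μ, 0 ≤ (v - c) * ((μ : Ω → ℝ) ω - t)) :
    ∫ μ, V μ ∂(τ : Measure (Belief Ω)) ≤ c := by
  have hnn : 0 ≤ ∫ μ, (V μ - c) * ((μ : Ω → ℝ) ω - t) ∂(τ : Measure (Belief Ω)) :=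
    integral_nonneg fun μ => hcross μ _ (hf.1.2 μ)
  have hi1 : Integrable V (τ : Measure (Belief Ω)) := (hf.1.memLp hV τ 1).integrable le_rfl
  have hi2 := (memLp_apply τ ω 1).integrable le_rfl
  have hi3 : Integrable (fun μ => V μ * (μ : Ω → ℝ) ω) (τ : Measure (Belief Ω)) :=
    (hf.1.memLp hV τ 2).integrable_mul (memLp_apply τ ω 2)
  -- Zero covariance lets the expectation of the product factor.
  have e : ∫ μ, (V μ - c) * ((μ : Ω → ℝ) ω - t) ∂(τ : Measure (Belief Ω)) =
      (∫ μ, V μ ∂(τ : Measure (Belief Ω)) - c) * ((p : Ω → ℝ) ω - t) := by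
    have e1 : (fun μ : Belief Ω => (V μ - c) * ((μ : Ω → ℝ) ω - t)) = fun μ : Belief Ω =>
        (V μ * (μ : Ω → ℝ) ω - t * V μ) - (c * (μ : Ω → ℝ) ω - c * t) := by
      funext μ; ring
    have e2 := integral_sub (hi3.sub (hi1.const_mul t))
      ((hi2.const_mul c).sub (integrable_const (c * t)))
    have e3 := integral_sub hi3 (hi1.const_mul t)
    have e4 := integral_sub (hi2.const_mul c) (integrable_const (μ := (τ : Measure (Belief Ω))) (c * t))
    simp only [Pi.sub_apply] at e2
    rw [e1, e2, e3, e4, integral_const_mul,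
      integral_const_mul, (zeroCov_iff hV hf.1 hf.2.1).1 hf.2.2 ω, hf.2.1 ω]
    simp only [integral_const, probReal_univ, one_smul]
    ring
  rw [e] at hnn
  by_contra! hlt
  nlinarith [mul_pos (sub_pos.2 hlt) (sub_pos.2 ht)]

/-- The threshold is the infimum of the beliefs where `max 𝐕 > c`: before it `max 𝐕 ≤ c`, after it
`min 𝐕 ≥ c`, and at it the product in the crossing condition vanishes. -/
lemma MediationFeasible.integral_le_of_monotone (hV : IsIntervalCorrespondence VV)
    (hf : MediationFeasible VV p τ V) {ω : Ω} {c : ℝ} (hp : upperEnvelope VV p < c)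
    (hmono : ∀ μ ν : Belief Ω, (μ : Ω → ℝ) ω < (ν : Ω → ℝ) ω → c < upperEnvelope VV μ →
      c ≤ lowerEnvelope VV ν)
    (hext : ∀ μ ν : Belief Ω, (μ : Ω → ℝ) ω = (ν : Ω → ℝ) ω → μ = ν) :
    ∫ μ, V μ ∂(τ : Measure (Belief Ω)) ≤ c := by
  by_cases hex : ∃ μ, c < upperEnvelope VV μ
  swap
  · push Not at hex
    calc ∫ μ, V μ ∂(τ : Measure (Belief Ω)) ≤ ∫ _, c ∂(τ : Measure (Belief Ω)) :=
          integral_mono ((hf.1.memLp hV τ 1).integrable le_rfl) (integrable_const _)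
            fun μ => (hV.le_upper (hf.1.2 μ)).trans (hex μ)
      _ = c := by simp
  have hge : ∀ μ, c < upperEnvelope VV μ → (p : Ω → ℝ) ω ≤ (μ : Ω → ℝ) ω := by
    intro μ hμ
    by_contra! h
    exact absurd ((hmono μ p h hμ).trans (hV.lower_le_upper p)) (not_le.2 hp)
  have hcont : Continuous fun μ : Belief Ω => (μ : Ω → ℝ) ω :=
    (continuous_apply ω).comp continuous_subtype_val
  -- The weak inequality `c ≤ max 𝐕` gives a compact set. Its point nearest to `p` differs from `p`,
  -- which keeps the threshold strictly beyond the prior.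
  have hK : IsCompact ({μ : Belief Ω | (p : Ω → ℝ) ω ≤ (μ : Ω → ℝ) ω} ∩
      {μ | c ≤ upperEnvelope VV μ}) :=
    ((isClosed_le continuous_const hcont).inter (hV.isClosed_upper c)).isCompact
  obtain ⟨μ₀, hμ₀⟩ := hex
  obtain ⟨m, ⟨hm1, hm2⟩, hmin⟩ := hK.exists_isMinOn ⟨μ₀, hge μ₀ hμ₀, hμ₀.le⟩ hcont.continuousOn
  have hpm : (p : Ω → ℝ) ω < (m : Ω → ℝ) ω := by
    refine lt_of_le_of_ne hm1 fun h => ?_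
    rw [← hext _ _ h] at hm2
    exact absurd hm2 (not_le.2 hp)
  let T : Set ℝ := (fun μ : Belief Ω => (μ : Ω → ℝ) ω) '' {μ | c < upperEnvelope VV μ}
  have hT : T.Nonempty := ⟨_, μ₀, hμ₀, rfl⟩
  have hTm : ∀ s ∈ T, (m : Ω → ℝ) ω ≤ s := by
    rintro _ ⟨μ, hμ, rfl⟩
    exact hmin ⟨hge μ hμ, (show c < upperEnvelope VV μ from hμ).le⟩
  refine hf.integral_le_of_crossing hV (lt_of_lt_of_le hpm (le_csInf hT hTm)) fun μ v hv => ?_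
  rcases lt_trichotomy ((μ : Ω → ℝ) ω) (sInf T) with h | h | h
  · refine mul_nonneg_of_nonpos_of_nonpos ?_ (sub_nonpos.2 h.le)
    have : upperEnvelope VV μ ≤ c := by
      by_contra! hc
      exact absurd (csInf_le ⟨_, hTm⟩ ⟨μ, hc, rfl⟩) (not_le.2 h)
    linarith [hV.le_upper hv]
  · rw [h]; simp
  · obtain ⟨_, ⟨ν, hν, rfl⟩, hνμ⟩ := exists_lt_of_csInf_lt hT h
    refine mul_nonneg ?_ (sub_nonneg.2 h.le)
    linarith [hmono ν μ hνμ hν, hV.lower_le hv]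

/-! ### Failure of mono-crossing gives mediation a gain -/

/-- If `𝐕` goes below and then above its quasiconcave envelope on one side of the prior, then
mediation does strictly better than this envelope. -/
lemma exists_mediationFeasible_lt (hV : IsIntervalCorrespondence VV) (hne : ω₁ ≠ ω₂)
    (hall : ∀ o, o = ω₁ ∨ o = ω₂)
    (hp : upperEnvelope VV p < quasiconcaveEnvelope VV p) {y y' : Belief Ω}
    (hyy : (y : Ω → ℝ) ω₁ < (y' : Ω → ℝ) ω₁) (hyp : (y' : Ω → ℝ) ω₁ < (p : Ω → ℝ) ω₁)
    (hy : lowerEnvelope VV y < quasiconcaveEnvelope VV p)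
    (hy' : quasiconcaveEnvelope VV p < upperEnvelope VV y') :
    ∃ τ V, MediationFeasible VV p τ V ∧
      quasiconcaveEnvelope VV p < ∫ μ, V μ ∂(τ : Measure (Belief Ω)) := by
  obtain ⟨z, hz, hqz⟩ := exists_mem_quasiconcaveEnvelope hV hne.symm (fun o => (hall o).symm) hp
  have hy1 := Belief.add_eq_one hne hall y
  have hy1' := Belief.add_eq_one hne hall y'
  have hz1 := Belief.add_eq_one hne hall z
  have hp1 := Belief.add_eq_one hne hall p
  have hpz : (p : Ω → ℝ) ω₁ < (z : Ω → ℝ) ω₁ := by linarith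
  obtain ⟨W, hW, hWy, hWV⟩ := hV.isMeasurableSelection_upper.update (hV.lower_mem y)
  obtain ⟨V, hVs, hVz, hVW⟩ := hW.update hqz
  have hVy : V y = lowerEnvelope VV y := by
    rw [hVW y (by rintro rfl; linarith), hWy]
  have hVy' : V y' = upperEnvelope VV y' := by
    rw [hVW y' (by rintro rfl; linarith), hWV y' (by rintro rfl; linarith)]
  set q := quasiconcaveEnvelope VV p
  -- `a`, `b` are the value gaps from `q` at `y`, `y'`; `d`, `d'`, `e` are the distances of `y`,
  -- `y'`, `z` from `p`.
  obtain ⟨a, ha⟩ : ∃ a, a = q - lowerEnvelope VV y := ⟨_, rfl⟩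
  obtain ⟨b, hb⟩ : ∃ b, b = upperEnvelope VV y' - q := ⟨_, rfl⟩
  obtain ⟨d, hd⟩ : ∃ d, d = (p : Ω → ℝ) ω₁ - (y : Ω → ℝ) ω₁ := ⟨_, rfl⟩
  obtain ⟨d', hd'⟩ : ∃ d', d' = (p : Ω → ℝ) ω₁ - (y' : Ω → ℝ) ω₁ := ⟨_, rfl⟩
  obtain ⟨e, he⟩ : ∃ e, e = (z : Ω → ℝ) ω₁ - (p : Ω → ℝ) ω₁ := ⟨_, rfl⟩
  have ha0 : 0 < a := by linarith
  have hb0 : 0 < b := by linarith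
  have hd0' : 0 < d' := by linarith
  have hdd : 0 < d - d' := by linarith
  have hd0 : 0 < d := by linarith
  have he0 : 0 < e := by linarith
  -- The weights solve `α d + β d' = γ e` (mean belief) and `α a d = β b d'` (zero covariance); `S`
  -- normalizes them.
  obtain ⟨S, hS⟩ : ∃ S, S = b * d' * e + a * d * e + d * d' * (a + b) := ⟨_, rfl⟩
  have hS0 : 0 < S := by rw [hS]; positivity
  obtain ⟨α, hα⟩ : ∃ α, α = b * d' * e / S := ⟨_, rfl⟩
  obtain ⟨β, hβ⟩ : ∃ β, β = a * d * e / S := ⟨_, rfl⟩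
  obtain ⟨γ, hγ⟩ : ∃ γ, γ = d * d' * (a + b) / S := ⟨_, rfl⟩
  have hα0 : 0 < α := by rw [hα]; positivity
  have hβ0 : 0 < β := by rw [hβ]; positivity
  have hγ0 : 0 < γ := by rw [hγ]; positivity
  have hsum : α + β + γ = 1 := by
    rw [hα, hβ, hγ, ← add_div, ← add_div, ← hS, div_self hS0.ne']
  have hmean : α * d + β * d' = γ * e := by rw [hα, hβ, hγ]; ring
  have hcov : α * a * d = β * b * d' := by rw [hα, hβ]; ring
  -- As `y'` is nearer to `p` (`d' < d`), balancing the covariance makes its upward deviation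
  -- outweigh the downward one.
  have hgain : 0 < β * b - α * a := by
    have : β * b - α * a = a * b * e * (d - d') / S := by rw [hα, hβ]; ring
    rw [this]; positivity
  have hb1 : α * (y : Ω → ℝ) ω₁ + β * (y' : Ω → ℝ) ω₁ + γ * (z : Ω → ℝ) ω₁ = (p : Ω → ℝ) ω₁ := by
    rw [hd, hd', he] at hmean
    linear_combination (p : Ω → ℝ) ω₁ * hsum - hmean
  have hyv : lowerEnvelope VV y = q - a := by linarith
  have hyv' : upperEnvelope VV y' = q + b := by linarith
  have hyd : (y : Ω → ℝ) ω₁ = (p : Ω → ℝ) ω₁ - d := by linarith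
  have hyd' : (y' : Ω → ℝ) ω₁ = (p : Ω → ℝ) ω₁ - d' := by linarith
  have hzd : (z : Ω → ℝ) ω₁ = (p : Ω → ℝ) ω₁ + e := by linarith
  obtain ⟨τ, hτ, -⟩ := exists_finitely_supported_distribution ![α, β, γ]
    (by simp [Fin.forall_fin_succ, hα0.le, hβ0.le, hγ0.le])
    (by simpa [Fin.sum_univ_three] using hsum) ![y, y', z]
  have hτ' : ∀ f : Belief Ω → ℝ, ∫ μ, f μ ∂(τ : Measure (Belief Ω)) =
      α * f y + β * f y' + γ * f z := fun f => by
    rw [hτ]; simp [Fin.sum_univ_three]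
  have hbayes : BayesPlausible p τ := by
    intro ω
    rw [hτ']
    rcases hall ω with rfl | rfl
    · exact hb1
    · linear_combination α * hy1 + β * hy1' + γ * hz1 - hp1 + hsum - hb1
  have hcov₁ : α * ((q - a) * (y : Ω → ℝ) ω₁) + β * ((q + b) * (y' : Ω → ℝ) ω₁) +
      γ * (q * (z : Ω → ℝ) ω₁) = (α * (q - a) + β * (q + b) + γ * q) * (p : Ω → ℝ) ω₁ := by
    rw [hyd, hyd', hzd]
    linear_combination hcov - q * hmean
  refine ⟨τ, V, ⟨hVs, hbayes, (zeroCov_iff hV hVs hbayes).2 fun ω => ?_⟩, ?_⟩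
  · rw [hτ', hτ', hVy, hVy', hVz, hyv, hyv']
    rcases hall ω with rfl | rfl
    · exact hcov₁
    · linear_combination α * (q - a) * hy1 + β * (q + b) * hy1' + γ * q * hz1 -
        (α * (q - a) + β * (q + b) + γ * q) * hp1 - hcov₁
  · rw [hτ', hVy, hVy', hVz, hyv, hyv']
    have : α * (q - a) + β * (q + b) + γ * q = q + (β * b - α * a) := by
      linear_combination q * hsum
    linarith

/-- By `hside`, a violating `y'` lies strictly before `p`, where `exists_mediationFeasible_lt`
contradicts `hle`. -/
lemma upper_le_of_forall_integral_le (hV : IsIntervalCorrespondence VV) (hne : ω₁ ≠ ω₂)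
    (hall : ∀ o, o = ω₁ ∨ o = ω₂)
    (hp : upperEnvelope VV p < quasiconcaveEnvelope VV p)
    (hle : ∀ τ V, MediationFeasible VV p τ V →
      ∫ μ, V μ ∂(τ : Measure (Belief Ω)) ≤ quasiconcaveEnvelope VV p)
    (hside : ∀ x : Belief Ω, (p : Ω → ℝ) ω₁ ≤ (x : Ω → ℝ) ω₁ →
      upperEnvelope VV x ≤ quasiconcaveEnvelope VV p)
    {y y' : Belief Ω} (hyy : (y : Ω → ℝ) ω₁ < (y' : Ω → ℝ) ω₁)
    (hy : lowerEnvelope VV y < quasiconcaveEnvelope VV p) :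
    upperEnvelope VV y' ≤ quasiconcaveEnvelope VV p := by
  by_contra! h
  have hyp : (y' : Ω → ℝ) ω₁ < (p : Ω → ℝ) ω₁ := by
    by_contra! h'
    exact absurd (hside y' h') (not_le.2 h)
  obtain ⟨τ, V, hf, hlt⟩ := exists_mediationFeasible_lt hV hne hall hp hyy hyp hy h
  exact absurd (hle τ V hf) (not_le.2 hlt)

/-- On one side of `p`, the values of `𝐕` do not exceed its quasiconcave envelope at `p`. -/
lemma upper_le_quasiconcaveEnvelope_or (hV : IsIntervalCorrespondence VV) (hne : ω₁ ≠ ω₂)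
    (hall : ∀ o, o = ω₁ ∨ o = ω₂) (p : Belief Ω) :
    (∀ x : Belief Ω, (p : Ω → ℝ) ω₁ ≤ (x : Ω → ℝ) ω₁ →
      upperEnvelope VV x ≤ quasiconcaveEnvelope VV p) ∨
    (∀ x : Belief Ω, (p : Ω → ℝ) ω₂ ≤ (x : Ω → ℝ) ω₂ →
      upperEnvelope VV x ≤ quasiconcaveEnvelope VV p) := by
  by_contra! h
  obtain ⟨⟨y, hy, hqy⟩, x, hx, hqx⟩ := h
  have hx1 := Belief.add_eq_one hne hall x
  have hp1 := Belief.add_eq_one hne hall p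
  -- Otherwise the smaller of the two excess values is reached on both sides and still exceeds the
  -- envelope.
  exact absurd (le_quasiconcaveEnvelope hV hne hall (by linarith) hy (min_le_left _ _)
    (min_le_right _ _)) (not_le.2 (lt_min hqx hqy))

end Feasibility

/-! ### Mono-crossing in terms of beliefs -/

section MonoCrossing

variable {Ω : Type*} [Fintype Ω] {VV : Belief Ω → Set ℝ} {ω₁ ω₂ : Ω}

lemma shiftedCorrespondence_apply (hne : ω₁ ≠ ω₂) (hall : ∀ o, o = ω₁ ∨ o = ω₂)
    (hV : IsIntervalCorrespondence VV) (c : ℝ) {x : Set.Icc (0 : ℝ) 1} {μ : Belief Ω}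
    (h : (μ : Ω → ℝ) ω₁ = x) :
    shiftedCorrespondence VV ω₁ c x =
      Set.Icc (lowerEnvelope VV μ - c) (upperEnvelope VV μ - c) := by
  ext y
  constructor
  · rintro ⟨ν, hν, v, hv, rfl⟩
    obtain rfl : ν = μ := Belief.ext_apply hne hall (hν.trans h.symm)
    exact ⟨sub_le_sub_right (hV.lower_le hv) c, sub_le_sub_right (hV.le_upper hv) c⟩
  · rintro ⟨h1, h2⟩
    refine ⟨μ, h, y + c, ?_, by ring⟩
    rw [hV.eq_Icc]
    exact ⟨by linarith, by linarith⟩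

/-- The abstract predicate `P` lets one transfer from `[0, 1]` to beliefs serve both directions of
crossing. -/
lemma forall_lt_shiftedCorrespondence (hne : ω₁ ≠ ω₂) (hall : ∀ o, o = ω₁ ∨ o = ω₂)
    (hV : IsIntervalCorrespondence VV) (c : ℝ) (P : ℝ → ℝ → ℝ → ℝ → Prop) :
    (∀ x x' : Set.Icc (0 : ℝ) 1, x < x' →
      P (lowerEnvelope (shiftedCorrespondence VV ω₁ c) x)
        (upperEnvelope (shiftedCorrespondence VV ω₁ c) x)
        (lowerEnvelope (shiftedCorrespondence VV ω₁ c) x')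
        (upperEnvelope (shiftedCorrespondence VV ω₁ c) x')) ↔
    ∀ μ ν : Belief Ω, (μ : Ω → ℝ) ω₁ < (ν : Ω → ℝ) ω₁ →
      P (lowerEnvelope VV μ - c) (upperEnvelope VV μ - c)
        (lowerEnvelope VV ν - c) (upperEnvelope VV ν - c) := by
  have hl : ∀ {x : Set.Icc (0 : ℝ) 1} {μ : Belief Ω}, (μ : Ω → ℝ) ω₁ = x →
      lowerEnvelope (shiftedCorrespondence VV ω₁ c) x = lowerEnvelope VV μ - c := by
    intro x μ h
    rw [lowerEnvelope, shiftedCorrespondence_apply hne hall hV c h,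
      csInf_Icc (sub_le_sub_right (hV.lower_le_upper μ) c)]
  have hu : ∀ {x : Set.Icc (0 : ℝ) 1} {μ : Belief Ω}, (μ : Ω → ℝ) ω₁ = x →
      upperEnvelope (shiftedCorrespondence VV ω₁ c) x = upperEnvelope VV μ - c := by
    intro x μ h
    rw [upperEnvelope, shiftedCorrespondence_apply hne hall hV c h,
      csSup_Icc (sub_le_sub_right (hV.lower_le_upper μ) c)]
  constructor
  · intro H μ ν h
    have := H ⟨_, mem_Icc_of_mem_stdSimplex μ.2 ω₁⟩ ⟨_, mem_Icc_of_mem_stdSimplex ν.2 ω₁⟩ h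
    rwa [hl (μ := μ) rfl, hu (μ := μ) rfl, hl (μ := ν) rfl, hu (μ := ν) rfl] at this
  · intro H x x' h
    obtain ⟨μ, hμ⟩ := Belief.exists_apply_eq hne hall x.2
    obtain ⟨ν, hν⟩ := Belief.exists_apply_eq hne hall x'.2
    rw [hl hμ, hu hμ, hl hν, hu hν]
    refine H μ ν ?_
    rw [hμ, hν]
    exact h

lemma monoCrossing_shiftedCorrespondence_iff (hne : ω₁ ≠ ω₂) (hall : ∀ o, o = ω₁ ∨ o = ω₂)
    (hV : IsIntervalCorrespondence VV) (c : ℝ) :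
    MonoCrossing (shiftedCorrespondence VV ω₁ c) ↔
      (∀ μ ν : Belief Ω, (μ : Ω → ℝ) ω₁ < (ν : Ω → ℝ) ω₁ → c < upperEnvelope VV μ →
        c ≤ lowerEnvelope VV ν) ∨
      (∀ μ ν : Belief Ω, (μ : Ω → ℝ) ω₁ < (ν : Ω → ℝ) ω₁ → lowerEnvelope VV μ < c →
        upperEnvelope VV ν ≤ c) := by
  refine or_congr ?_ ?_
  · exact (forall_lt_shiftedCorrespondence hne hall hV c fun _ a b _ => 0 < a → 0 ≤ b).trans
      (by simp only [sub_pos, sub_nonneg])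
  · exact (forall_lt_shiftedCorrespondence hne hall hV c fun a _ _ b => a < 0 → b ≤ 0).trans
      (by simp only [sub_neg, sub_nonpos])

end MonoCrossing

end MediatedCommunication
end

/-! ### The characterization -/

theorem proposition3 {Ω A : Type*} [Fintype Ω] (hΩ : Fintype.card Ω = 2) (ω₁ : Ω)
    [MetricSpace A] [CompactSpace A] [Nonempty A]
    (uS : A → ℝ) (huS : Continuous uS)
    (uR : Ω → A → ℝ) (huR : ∀ ω, Continuous (uR ω))
    (p : MediatedCommunication.Belief Ω) (hp : ∀ ω, 0 < (p : Ω → ℝ) ω)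
    (hND : MediatedCommunication.NoDisclosureSuboptimal
      (MediatedCommunication.valueCorrespondence uS uR) p) :
    MediatedCommunication.mediationValue (MediatedCommunication.valueCorrespondence uS uR) p =
        MediatedCommunication.cheapTalkValue (MediatedCommunication.valueCorrespondence uS uR) p ↔
      MediatedCommunication.MonoCrossing
        (MediatedCommunication.shiftedCorrespondence
          (MediatedCommunication.valueCorrespondence uS uR) ω₁
          (MediatedCommunication.quasiconcaveEnvelope
            (MediatedCommunication.valueCorrespondence uS uR) p)) := by
  obtain ⟨ω₂, hne, hall⟩ := MediatedCommunication.exists_ne_and_forall_eq_or_eq hΩ ω₁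
  have hall' : ∀ o, o = ω₂ ∨ o = ω₁ := fun o => (hall o).symm
  have hV := MediatedCommunication.isIntervalCorrespondence_valueCorrespondence huS huR
  have hlt := hND.upper_lt hV hne hall
  -- Exchanging the states reverses the order and so swaps crossing from below with crossing from
  -- above.
  have hflip : ∀ μ ν : MediatedCommunication.Belief Ω,
      (μ : Ω → ℝ) ω₁ < (ν : Ω → ℝ) ω₁ ↔ (ν : Ω → ℝ) ω₂ < (μ : Ω → ℝ) ω₂ := fun μ ν => by
    have h1 := MediatedCommunication.Belief.add_eq_one hne hall μ
    have h2 := MediatedCommunication.Belief.add_eq_one hne hall ν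
    constructor <;> intro h <;> linarith
  rw [MediatedCommunication.cheapTalkValue_eq hV hne hall hlt,
    MediatedCommunication.mediationValue_eq_iff hV hne hall hlt,
    MediatedCommunication.monoCrossing_shiftedCorrespondence_iff hne hall hV]
  constructor
  · intro hle
    rcases MediatedCommunication.upper_le_quasiconcaveEnvelope_or hV hne hall p with hs | hs
    · exact Or.inr fun μ ν h hμ =>
        MediatedCommunication.upper_le_of_forall_integral_le hV hne hall hlt hle hs h hμ
    · refine Or.inl fun μ ν h hμ => ?_
      by_contra! hν
      exact absurd (MediatedCommunication.upper_le_of_forall_integral_le hV hne.symm hall' hlt hle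
        hs ((hflip μ ν).1 h) hν) (not_le.2 hμ)
  · rintro (h | h) τ V hf
    · exact hf.integral_le_of_monotone hV hlt h
        fun μ ν => MediatedCommunication.Belief.ext_apply hne hall
    · refine hf.integral_le_of_monotone hV (ω := ω₂) hlt (fun μ ν hμν hμ => ?_)
        fun μ ν => MediatedCommunication.Belief.ext_apply hne.symm hall'
      by_contra! hν
      exact absurd (h ν μ ((hflip ν μ).2 hμν) hν) (not_le.2 hμ)
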